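/- For $n\ge 3$ let $P(n,2)$ be the simple graph with the $2n$ vertices $u_i,v_i$ and the edges $u_iu_{i+1}$, $u_iv_i$, $v_iv_{i+2}$, where $i\in\mathbb{Z}/n\mathbb{Z}$ and subscripts are taken modulo $n$. For a finite graph $G$, let the domination number $\gamma(G)$ be the minimum cardinality of a set $S$ of vertices such that every vertex is in $S$ or adjacent to a vertex of $S$. Let the alteration domination number $\mu(G)$ be the minimum number of vertices whose removal increases or decreases $\gamma(G)$, and let the bondage number $b(G)$ be the minimum number of edges whose removal from $G$ results in a graph with larger domination number. Then for every $n\ge 3$: (1) if $n\equiv 1$ or $2\pmod 5$, then $\mu(P(n,2))=1$; (2) otherwise, $\mu(P(n,2))\ge 2$; (3) if $n\equiv 0$, $3$ or $4\pmod 5$, then $2\le b(P(n,2))\le 3$. -/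

import Mathlib

/-- Adjacency rule of the generalized Petersen graph in one direction: `Sum.inl i` is the outer
vertex `u_i` and `Sum.inr i` the inner vertex `v_i`, with subscripts modulo `n`. The edges are
`u_i u_{i+1}`, `u_i v_i` and `v_i v_{i+k}`. -/
def petersenRel (n k : ℕ) : ZMod n ⊕ ZMod n → ZMod n ⊕ ZMod n → Prop
  | Sum.inl i, Sum.inl j => j = i + 1
  | Sum.inl i, Sum.inr j => j = i
  | Sum.inr i, Sum.inr j => j = i + (k : ZMod n)
  | Sum.inr _, Sum.inl _ => False

/-- The generalized Petersen graph `P(n,k)` on the `2n` vertices `u_i, v_i`. -/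
def generalizedPetersen (n k : ℕ) : SimpleGraph (ZMod n ⊕ ZMod n) :=
  SimpleGraph.fromRel (petersenRel n k)

/-- `S` is a dominating set: the closed neighbourhood of `S` is the whole vertex set. -/
def IsDominatingSet {V : Type*} (G : SimpleGraph V) (S : Finset V) : Prop :=
  ∀ v : V, v ∈ S ∨ ∃ w ∈ S, G.Adj w v

/-- The domination number `γ(G)` of a finite graph: the least cardinality of a dominating set
(the whole vertex set is one, so the minimum exists). -/
noncomputable def dominationNumber {V : Type*} (G : SimpleGraph V) : ℕ :=
  sInf {m : ℕ | ∃ S : Finset V, IsDominatingSet G S ∧ S.card = m}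

/-- The graph `G - X` obtained from `G` by removing the vertices in `X`. -/
def removeVertices {V : Type*} (G : SimpleGraph V) (X : Finset V) : SimpleGraph {v : V | v ∉ X} :=
  G.induce {v : V | v ∉ X}

/-- The alteration domination number `μ(G)`: the least number of vertices whose removal increases
or decreases the domination number. For a finite nonempty graph the minimum exists, since
removing every vertex changes the domination number to `0`. -/
noncomputable def alterationDominationNumber {V : Type*} (G : SimpleGraph V) : ℕ :=
  sInf {m : ℕ | ∃ X : Finset V,
    dominationNumber (removeVertices G X) ≠ dominationNumber G ∧ X.card = m}

/-- The bondage number `b(G)`: the least number of edges of `G` whose removal results in a graph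
with larger domination number. For a finite graph with at least one edge the minimum exists,
since removing every edge makes the domination number equal to the number of vertices. -/
noncomputable def bondageNumber {V : Type*} (G : SimpleGraph V) : ℕ :=
  sInf {m : ℕ | ∃ F : Finset (Sym2 V), (F : Set (Sym2 V)) ⊆ G.edgeSet ∧
    dominationNumber G < dominationNumber (G.deleteEdges (F : Set (Sym2 V))) ∧ F.card = m}

/-! Domination in $P(n,2)$ is local in the columns, so a vertex set is a closed walk of length $n$
on 64 states, each step paying for one new column. A potential $\varphi$ with $\varphi(\text{next})
+ 3 \le \varphi + 5\,\text{cost}$ telescopes around the cycle to $3n \le 5|S|$ for every dominating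
set $S$. If a single vertex $x$ may stay undominated, one step loses at most 3, so $3n \le 5|S| +
3$. This loss is attained when $n \equiv 1 \pmod 5$, so for $n \equiv 4$ the loss is reduced to 1 by
potentials that also depend on the column modulo 5.

For $n \equiv 0, 3, 4$ these bounds round up to $\lceil 3n/5\rceil$, which a pattern of period 5
attains. Hence $\gamma = \lceil 3n/5\rceil$, and dominating all vertices but one is no cheaper.
Deleting $x$ therefore cannot lower $\gamma$, and it cannot raise it because some minimum dominating
set avoids $x$, so $\mu \ge 2$. Isolating $u_0$ by deleting its three edges forces $u_0$ into every
dominating set, and the rest still has to dominate all other vertices, so $b \le 3$. Every single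
edge is harmless for some minimum dominating set, so $b \ge 2$.

For $n \equiv 1, 2$ another pattern misses just one vertex with fewer than $3n/5$ elements. Deleting
that vertex lowers $\gamma$, so $\mu = 1$. -/

/-! ### Lower bounds by a potential argument

A vertex set of `P(n,2)` is read column by column as two sequences `U V : ℕ → Bool`. The six bits
of the columns `j, …, j + 3` that matter for the next step form a state, and a potential on states
whose increments are bounded by `5 * cost - 3` yields `3 * n ≤ 5 * card` after one full turn. -/

/-- The value at a state of the potential whose table has the base-16 digits of `N`. -/
def statePotential (N : ℕ) (u₀ u₁ v₀ v₁ v₂ v₃ : Bool) : ℕ :=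
  N / 16 ^ (u₀.toNat + 2 * u₁.toNat + 4 * v₀.toNat + 8 * v₁.toNat + 16 * v₂.toNat
    + 32 * v₃.toNat) % 16

/-- Potential table for arbitrary `n`. -/
def uniformTable : ℕ :=
  77194726131250850162631654789677758042186966440343293525940934674365895902512

/-- Potential tables, by the residue of the column modulo 5, used when the exceptional vertex is
an inner vertex or an outer vertex `u_i` with `v_{i-1}` outside the set. -/
def phaseTable : ℕ → ℕ
  | 0 => 92633671362893009552441119456040552554510788373339645057676246832302364272466
  | 1 => 92633671362893009552441119456040931671943121723123067525683836248115950949696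
  | 2 => 92633671362893009539886915983806447434835689741027870312692174562357216126545
  | 3 => 92633671308972704634856152298891690103711010041672332282503507316501063706450
  | _ => 92631904488868284400501215777424996731115850183090383187050368606330391209554

/-- Potential tables, by the residue of the column modulo 5, used when the exceptional vertex is
an outer vertex `u_i` with `v_{i-1}` in the set. -/
def phaseTable' : ℕ → ℕ
  | 0 => 92633671362892598163747585685213202976771314767205699613743908833598071220050
  | 1 => 92633671308973116017272392769467505545070062896536291301396012488417158145874
  | 2 => 92631904515827408415806822733784906936044282375906873647164367747511984957010
  | 3 => 92633671362893009552441119457502054191841696483840188424629939134462111745842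
  | _ => 92633671362893009552441119454579809147280593825512788800768484060960300311888

/-- A finite check over all transitions. Such a potential exists because every closed walk costs at
least 3/5 per step on average. -/
theorem uniformTable_step : ∀ u₀ u₁ u₂ v₀ v₁ v₂ v₃ v₄ : Bool,
    (u₀ || u₁ || u₂ || v₃) = true → (v₀ || v₂ || v₄ || u₀) = true →
    statePotential uniformTable u₁ u₂ v₁ v₂ v₃ v₄ + 3 ≤
      statePotential uniformTable u₀ u₁ v₀ v₁ v₂ v₃ + 5 * (u₂.toNat + v₄.toNat) := by
  decide +kernel

theorem uniformTable_exceptional_step : ∀ u₀ u₁ u₂ v₀ v₁ v₂ v₃ v₄ : Bool,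
    (u₀ || u₁ || u₂ || v₃) = true ∨ (v₀ || v₂ || v₄ || u₀) = true →
    statePotential uniformTable u₁ u₂ v₁ v₂ v₃ v₄ + 3 ≤
      statePotential uniformTable u₀ u₁ v₀ v₁ v₂ v₃ + 5 * (u₂.toNat + v₄.toNat) + 3 := by
  decide +kernel

theorem phaseTable_step : ∀ p : Fin 5, ∀ u₀ u₁ u₂ v₀ v₁ v₂ v₃ v₄ : Bool,
    (u₀ || u₁ || u₂ || v₃) = true → (v₀ || v₂ || v₄ || u₀) = true →
    statePotential (phaseTable ((p + 1) % 5)) u₁ u₂ v₁ v₂ v₃ v₄ + 3 ≤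
      statePotential (phaseTable p) u₀ u₁ v₀ v₁ v₂ v₃ + 5 * (u₂.toNat + v₄.toNat) := by
  decide +kernel

/-- The exceptional step jumps from phase 4 to phase 1, skipping phase 0. With $n - 1$ ordinary
steps the phase advances by $n + 1 \equiv 0 \pmod 5$, so it closes up exactly when $n \equiv 4$. -/
theorem phaseTable_exceptional_step : ∀ u₀ u₁ u₂ v₀ v₁ v₂ v₃ v₄ : Bool,
    (u₀ || u₁ || u₂ || v₃) = true ∨ ((v₀ || v₂ || v₄ || u₀) = true ∧ v₂ = false) →
    statePotential (phaseTable 1) u₁ u₂ v₁ v₂ v₃ v₄ + 3 ≤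
      statePotential (phaseTable 4) u₀ u₁ v₀ v₁ v₂ v₃ + 5 * (u₂.toNat + v₄.toNat) + 1 := by
  decide +kernel

theorem phaseTable'_step : ∀ p : Fin 5, ∀ u₀ u₁ u₂ v₀ v₁ v₂ v₃ v₄ : Bool,
    (u₀ || u₁ || u₂ || v₃) = true → (v₀ || v₂ || v₄ || u₀) = true →
    statePotential (phaseTable' ((p + 1) % 5)) u₁ u₂ v₁ v₂ v₃ v₄ + 3 ≤
      statePotential (phaseTable' p) u₀ u₁ v₀ v₁ v₂ v₃ + 5 * (u₂.toNat + v₄.toNat) := by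
  decide +kernel

theorem phaseTable'_exceptional_step : ∀ u₀ u₁ u₂ v₀ v₁ v₃ v₄ : Bool,
    statePotential (phaseTable' 1) u₁ u₂ v₁ true v₃ v₄ + 3 ≤
      statePotential (phaseTable' 4) u₀ u₁ v₀ v₁ true v₃ + 5 * (u₂.toNat + v₄.toNat) + 1 := by
  decide +kernel

/-- The potential of the state formed by the columns `j, …, j + 3`. -/
def windowPotential (N : ℕ) (U V : ℕ → Bool) (j : ℕ) : ℕ :=
  statePotential N (U (j + 2)) (U (j + 3)) (V j) (V (j + 1)) (V (j + 2)) (V (j + 3))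

/-- The outer vertex of column `j + 3` is dominated. -/
def OuterDominated (U V : ℕ → Bool) (j : ℕ) : Prop :=
  (U (j + 2) || U (j + 3) || U (j + 4) || V (j + 3)) = true

/-- The inner vertex of column `j + 2` is dominated. -/
def InnerDominated (U V : ℕ → Bool) (j : ℕ) : Prop :=
  (V j || V (j + 2) || V (j + 4) || U (j + 2)) = true

theorem three_mul_le_of_potential {n k : ℕ} (hn : 0 < n) {φ c : ℕ → ℕ}
    (h0 : φ 1 + 3 ≤ φ 0 + 5 * c 0 + k)
    (hstep : ∀ j, 0 < j → j < n → φ (j + 1) + 3 ≤ φ j + 5 * c j) (hper : φ n = φ 0) :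
    3 * n ≤ 5 * ∑ j ∈ Finset.range n, c j + k := by
  -- The induction starts after step 0, the only step allowed the slack `k`.
  have key : ∀ m, m < n →
      φ (m + 1) + 3 * (m + 1) ≤ φ 0 + 5 * ∑ j ∈ Finset.range (m + 1), c j + k := by
    intro m
    induction m with
    | zero => intro _; simpa using h0
    | succ m ih =>
      intro hm
      have h1 := ih (by omega)
      have h2 := hstep (m + 1) (by omega) hm
      rw [Finset.sum_range_succ]
      omega
  obtain ⟨m, rfl⟩ : ∃ m, n = m + 1 := ⟨n - 1, by omega⟩
  have := key m (by omega)
  omega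

/-! ### Periodic 0-1 sequences -/

section Sequences

variable {n : ℕ} {U V : ℕ → Bool}

theorem windowPotential_period (hU : ∀ j, U (j + n) = U j) (hV : ∀ j, V (j + n) = V j) (N : ℕ) :
    windowPotential N U V n = windowPotential N U V 0 := by
  have h : ∀ k, U (n + k) = U (0 + k) ∧ V (n + k) = V (0 + k) := fun k => by
    rw [add_comm n, zero_add]; exact ⟨hU k, hV k⟩
  have h0 := (h 0).2
  simp only [add_zero] at h0
  simp only [windowPotential, (h _).1, (h _).2, h0]

theorem three_mul_le_of_dominated (hn : 0 < n) (hU : ∀ j, U (j + n) = U j)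
    (hV : ∀ j, V (j + n) = V j) (h : ∀ j < n, OuterDominated U V j ∧ InnerDominated U V j) :
    3 * n ≤ 5 * ∑ j ∈ Finset.range n, ((U (j + 4)).toNat + (V (j + 4)).toNat) :=
  three_mul_le_of_potential (k := 0) (φ := windowPotential uniformTable U V) hn
    (uniformTable_step _ _ _ _ _ _ _ _ (h 0 hn).1 (h 0 hn).2)
    (fun j _ hj => uniformTable_step _ _ _ _ _ _ _ _ (h j hj).1 (h j hj).2)
    (windowPotential_period hU hV _)

theorem three_mul_le_of_dominated_except (hn : 0 < n) (hU : ∀ j, U (j + n) = U j)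
    (hV : ∀ j, V (j + n) = V j)
    (h : ∀ j, 0 < j → j < n → OuterDominated U V j ∧ InnerDominated U V j)
    (h0 : OuterDominated U V 0 ∨ InnerDominated U V 0) :
    3 * n ≤ 5 * ∑ j ∈ Finset.range n, ((U (j + 4)).toNat + (V (j + 4)).toNat) + 3 :=
  three_mul_le_of_potential (φ := windowPotential uniformTable U V) hn
    (uniformTable_exceptional_step _ _ _ _ _ _ _ _ h0)
    (fun j hj hj' => uniformTable_step _ _ _ _ _ _ _ _ (h j hj hj').1 (h j hj hj').2)
    (windowPotential_period hU hV _)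

theorem three_mul_le_of_phase (T : ℕ → ℕ) (hn : n % 5 = 4) (hU : ∀ j, U (j + n) = U j)
    (hV : ∀ j, V (j + n) = V j)
    (hT : ∀ p : Fin 5, ∀ u₀ u₁ u₂ v₀ v₁ v₂ v₃ v₄ : Bool,
      (u₀ || u₁ || u₂ || v₃) = true → (v₀ || v₂ || v₄ || u₀) = true →
      statePotential (T ((p + 1) % 5)) u₁ u₂ v₁ v₂ v₃ v₄ + 3 ≤
        statePotential (T p) u₀ u₁ v₀ v₁ v₂ v₃ + 5 * (u₂.toNat + v₄.toNat))
    (h : ∀ j, 0 < j → j < n → OuterDominated U V j ∧ InnerDominated U V j)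
    (h0 : windowPotential (T 1) U V 1 + 3 ≤
      windowPotential (T 4) U V 0 + 5 * ((U 4).toNat + (V 4).toNat) + 1) :
    3 * n ≤ 5 * ∑ j ∈ Finset.range n, ((U (j + 4)).toNat + (V (j + 4)).toNat) + 1 := by
  refine three_mul_le_of_potential
    -- Column 0 gets phase 4 instead of 0, so that the potential agrees at `0` and at `n`, where `n
    -- % 5 = 4`.
    (φ := fun j => windowPotential (T (if j = 0 then 4 else j % 5)) U V j) (by omega) ?_ ?_ ?_
  · simpa using h0
  · intro j hj hj'
    -- The bit `v₁` occurs in neither domination condition, so unification cannot find it.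
    have hs := hT ⟨j % 5, by omega⟩ _ _ _ _ (V (j + 1)) _ _ _ (h j hj hj').1 (h j hj hj').2
    simp only [Nat.mod_add_mod] at hs
    simp only [Nat.succ_ne_zero, if_false, hj.ne']
    exact hs
  · have : n ≠ 0 := by omega
    simp only [this, if_false, if_true, hn]
    exact windowPotential_period hU hV _

theorem three_mul_le_of_dominated_except_of_mod_eq_four (hn : n % 5 = 4)
    (hU : ∀ j, U (j + n) = U j) (hV : ∀ j, V (j + n) = V j)
    (h : ∀ j, 0 < j → j < n → OuterDominated U V j ∧ InnerDominated U V j)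
    (h0 : OuterDominated U V 0 ∨ InnerDominated U V 0) :
    3 * n ≤ 5 * ∑ j ∈ Finset.range n, ((U (j + 4)).toNat + (V (j + 4)).toNat) + 1 := by
  by_cases hx : OuterDominated U V 0 ∨ (InnerDominated U V 0 ∧ V 2 = false)
  · exact three_mul_le_of_phase phaseTable hn hU hV phaseTable_step h
      (phaseTable_exceptional_step _ _ _ _ _ _ _ _ hx)
  -- If `V 2` were false, `h0` would fall under the first case. With `V 2` true the inner vertex of
  -- column 2 dominates itself, so the second table needs no domination hypothesis in this step.
  · have hv : V 2 = true := by
      cases hv : V 2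
      · exact absurd (h0.imp_right fun h => ⟨h, hv⟩) hx
      · rfl
    refine three_mul_le_of_phase phaseTable' hn hU hV phaseTable'_step h ?_
    have := phaseTable'_exceptional_step (U 2) (U 3) (U 4) (V 0) (V 1) (V 3) (V 4)
    rw [← hv] at this
    exact this

end Sequences

/-! ### Vertex sets of $P(n,2)$ as periodic sequences -/

section Graph

variable {n : ℕ}

theorem generalizedPetersen_adj_inl_inl {k : ℕ} {i j : ZMod n} :
    (generalizedPetersen n k).Adj (Sum.inl i) (Sum.inl j) ↔ i ≠ j ∧ (j = i + 1 ∨ i = j + 1) := by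
  simp [generalizedPetersen, petersenRel]

theorem generalizedPetersen_adj_inr_inr {k : ℕ} {i j : ZMod n} :
    (generalizedPetersen n k).Adj (Sum.inr i) (Sum.inr j) ↔ i ≠ j ∧ (j = i + k ∨ i = j + k) := by
  simp [generalizedPetersen, petersenRel]

theorem generalizedPetersen_adj_inl_inr {k : ℕ} {i j : ZMod n} :
    (generalizedPetersen n k).Adj (Sum.inl i) (Sum.inr j) ↔ i = j := by
  simp [generalizedPetersen, petersenRel, eq_comm]

theorem generalizedPetersen_adj_inr_inl {k : ℕ} {i j : ZMod n} :
    (generalizedPetersen n k).Adj (Sum.inr i) (Sum.inl j) ↔ i = j := by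
  simp [generalizedPetersen, petersenRel]

/-- The closed neighbourhood of `v` meets `S`. -/
def IsDominated {V : Type*} (G : SimpleGraph V) (S : Finset V) (v : V) : Prop :=
  v ∈ S ∨ ∃ w ∈ S, G.Adj w v

theorem isDominated_inl_iff (hn : 2 ≤ n) {S : Finset (ZMod n ⊕ ZMod n)} {i : ZMod n} :
    IsDominated (generalizedPetersen n 2) S (Sum.inl i) ↔
      Sum.inl (i - 1) ∈ S ∨ Sum.inl i ∈ S ∨ Sum.inl (i + 1) ∈ S ∨ Sum.inr i ∈ S := by
  have : Fact (1 < n) := ⟨by omega⟩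
  constructor
  · rintro (h | ⟨w | w, hw, h⟩)
    · exact Or.inr (Or.inl h)
    · rw [generalizedPetersen_adj_inl_inl] at h
      obtain ⟨-, rfl | rfl⟩ := h <;> simp [hw]
    · rw [generalizedPetersen_adj_inr_inl] at h
      subst h; simp [hw]
  · rintro (h | h | h | h)
    · exact Or.inr ⟨_, h, by simp [generalizedPetersen_adj_inl_inl]⟩
    · exact Or.inl h
    · exact Or.inr ⟨_, h, by simp [generalizedPetersen_adj_inl_inl]⟩
    · exact Or.inr ⟨_, h, by simp [generalizedPetersen_adj_inr_inl]⟩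

theorem two_ne_zero_zmod (hn : 3 ≤ n) : (2 : ZMod n) ≠ 0 := by
  intro h
  have := (ZMod.natCast_eq_zero_iff 2 n).1 (by exact_mod_cast h)
  exact absurd (Nat.le_of_dvd (by norm_num) this) (by omega)

theorem isDominated_inr_iff (hn : 3 ≤ n) {S : Finset (ZMod n ⊕ ZMod n)} {i : ZMod n} :
    IsDominated (generalizedPetersen n 2) S (Sum.inr i) ↔
      Sum.inr (i - 2) ∈ S ∨ Sum.inr i ∈ S ∨ Sum.inr (i + 2) ∈ S ∨ Sum.inl i ∈ S := by
  have h2 := two_ne_zero_zmod hn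
  constructor
  · rintro (h | ⟨w | w, hw, h⟩)
    · exact Or.inr (Or.inl h)
    · rw [generalizedPetersen_adj_inl_inr] at h
      subst h; simp [hw]
    · rw [generalizedPetersen_adj_inr_inr] at h
      push_cast at h
      obtain ⟨-, rfl | rfl⟩ := h <;> simp [hw]
  · rintro (h | h | h | h)
    · exact Or.inr ⟨_, h, by simp [generalizedPetersen_adj_inr_inr, h2]⟩
    · exact Or.inl h
    · exact Or.inr ⟨_, h, by simp [generalizedPetersen_adj_inr_inr, h2]⟩
    · exact Or.inr ⟨_, h, by simp [generalizedPetersen_adj_inl_inr]⟩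

theorem sum_range_natCast_zmod [NeZero n] (f : ZMod n → ℕ) :
    ∑ j ∈ Finset.range n, f (j : ZMod n) = ∑ i, f i := by
  refine Finset.sum_bij (fun j _ => (j : ZMod n)) (by simp) ?_ ?_ (by simp)
  · intro a ha b hb h
    rw [ZMod.natCast_eq_natCast_iff'] at h
    rwa [Nat.mod_eq_of_lt (Finset.mem_range.1 ha), Nat.mod_eq_of_lt (Finset.mem_range.1 hb)] at h
  · intro i _
    exact ⟨i.val, Finset.mem_range.2 i.val_lt, ZMod.natCast_zmod_val i⟩

/-- The outer vertices of `S`, read from column `a` on. -/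
def outerSeq (S : Finset (ZMod n ⊕ ZMod n)) (a : ZMod n) (j : ℕ) : Bool :=
  decide (Sum.inl (a + j) ∈ S)

/-- The inner vertices of `S`, read from column `a` on. -/
def innerSeq (S : Finset (ZMod n ⊕ ZMod n)) (a : ZMod n) (j : ℕ) : Bool :=
  decide (Sum.inr (a + j) ∈ S)

theorem outerSeq_period (S : Finset (ZMod n ⊕ ZMod n)) (a : ZMod n) (j : ℕ) :
    outerSeq S a (j + n) = outerSeq S a j := by simp [outerSeq]

theorem innerSeq_period (S : Finset (ZMod n ⊕ ZMod n)) (a : ZMod n) (j : ℕ) :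
    innerSeq S a (j + n) = innerSeq S a j := by simp [innerSeq]

/-- Step `j` pays for the newly entered column `j + 4`; over one full turn every column is paid for
once. -/
theorem sum_seq_eq_card [NeZero n] (S : Finset (ZMod n ⊕ ZMod n)) (a : ZMod n) :
    ∑ j ∈ Finset.range n, ((outerSeq S a (j + 4)).toNat + (innerSeq S a (j + 4)).toNat)
      = S.card := by
  let f : ZMod n → ℕ := fun i =>
    (decide (Sum.inl i ∈ S)).toNat + (decide (Sum.inr i ∈ S)).toNat
  have h1 : ∀ j : ℕ, (outerSeq S a (j + 4)).toNat + (innerSeq S a (j + 4)).toNat =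
      f ((a + 4) + j) := by
    intro j
    simp only [outerSeq, innerSeq, f]
    push_cast
    rw [show a + ((j : ZMod n) + 4) = a + 4 + j by ring]
  rw [Finset.sum_congr rfl fun j _ => h1 j, sum_range_natCast_zmod (fun i => f (a + 4 + i)),
    show ∑ i, f (a + 4 + i) = ∑ i, f i from Equiv.sum_comp (Equiv.addLeft (a + 4)) f,
    Finset.sum_add_distrib]
  have h2 : S.card = ∑ x : ZMod n ⊕ ZMod n, (decide (x ∈ S)).toNat := by
    simp [Bool.toNat, Bool.cond_decide]
  rw [h2, Fintype.sum_sum_type]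

theorem outerDominated_of_isDominated (hn : 2 ≤ n) {S : Finset (ZMod n ⊕ ZMod n)} {a : ZMod n}
    {j : ℕ} (h : IsDominated (generalizedPetersen n 2) S (Sum.inl (a + 3 + j))) :
    OuterDominated (outerSeq S a) (innerSeq S a) j := by
  rw [isDominated_inl_iff hn] at h
  simp only [OuterDominated, outerSeq, innerSeq, Bool.or_eq_true, decide_eq_true_eq]
  push_cast
  rw [show a + 3 + j - 1 = a + (j + 2) by ring, show a + 3 + j + 1 = a + (j + 4 : ZMod n) by ring,
    show a + 3 + j = a + (j + 3 : ZMod n) by ring] at h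
  tauto

theorem innerDominated_of_isDominated (hn : 3 ≤ n) {S : Finset (ZMod n ⊕ ZMod n)} {a : ZMod n}
    {j : ℕ} (h : IsDominated (generalizedPetersen n 2) S (Sum.inr (a + 2 + j))) :
    InnerDominated (outerSeq S a) (innerSeq S a) j := by
  rw [isDominated_inr_iff hn] at h
  simp only [InnerDominated, outerSeq, innerSeq, Bool.or_eq_true, decide_eq_true_eq]
  push_cast
  rw [show a + 2 + j - 2 = a + j by ring, show a + 2 + j + 2 = a + (j + 4 : ZMod n) by ring,
    show a + 2 + j = a + (j + 2 : ZMod n) by ring] at h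
  tauto

/-- Only periodicity of the sequences is used, so windows longer than the cycle, as for $n = 3$ and
$n = 4$, need no separate treatment. -/
theorem three_mul_le_card_of_isDominatingSet (hn : 3 ≤ n) {S : Finset (ZMod n ⊕ ZMod n)}
    (h : IsDominatingSet (generalizedPetersen n 2) S) : 3 * n ≤ 5 * S.card := by
  have : NeZero n := ⟨by omega⟩
  rw [← sum_seq_eq_card S 0]
  exact three_mul_le_of_dominated (by omega) (outerSeq_period S 0) (innerSeq_period S 0)
    fun j _ => ⟨outerDominated_of_isDominated (by omega) (h _),
      innerDominated_of_isDominated hn (h _)⟩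

/-- The walk starts so that `x` is tested in step 0. An outer vertex is tested at offset 3 and an
inner one at offset 2, so step 0 also tests a vertex of the other kind, which is dominated. -/
theorem exists_start_of_dominated_except (hn : 3 ≤ n) {S : Finset (ZMod n ⊕ ZMod n)}
    {x : ZMod n ⊕ ZMod n} (h : ∀ v ≠ x, IsDominated (generalizedPetersen n 2) S v) :
    ∃ a : ZMod n,
      (∀ j, 0 < j → j < n → OuterDominated (outerSeq S a) (innerSeq S a) j ∧
        InnerDominated (outerSeq S a) (innerSeq S a) j) ∧
      (OuterDominated (outerSeq S a) (innerSeq S a) 0 ∨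
        InnerDominated (outerSeq S a) (innerSeq S a) 0) := by
  have hj0 : ∀ j : ℕ, 0 < j → j < n → (j : ZMod n) ≠ 0 := fun j h1 h2 h3 =>
    absurd (Nat.le_of_dvd h1 ((ZMod.natCast_eq_zero_iff j n).1 h3)) (by omega)
  obtain i | i := x
  · refine ⟨i - 3, fun j h1 h2 => ⟨outerDominated_of_isDominated (by omega) (h _ ?_),
      innerDominated_of_isDominated hn (h _ (by simp))⟩,
      Or.inr (innerDominated_of_isDominated hn (h _ (by simp)))⟩
    simpa using hj0 j h1 h2
  · refine ⟨i - 2, fun j h1 h2 => ⟨outerDominated_of_isDominated (by omega) (h _ (by simp)),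
      innerDominated_of_isDominated hn (h _ ?_)⟩,
      Or.inl (outerDominated_of_isDominated (by omega) (h _ (by simp)))⟩
    simpa using hj0 j h1 h2

theorem three_mul_le_card_of_dominated_except (hn : 3 ≤ n) {S : Finset (ZMod n ⊕ ZMod n)}
    {x : ZMod n ⊕ ZMod n} (h : ∀ v ≠ x, IsDominated (generalizedPetersen n 2) S v) :
    3 * n ≤ 5 * S.card + 3 ∧ (n % 5 = 4 → 3 * n ≤ 5 * S.card + 1) := by
  have : NeZero n := ⟨by omega⟩
  obtain ⟨a, ha, ha0⟩ := exists_start_of_dominated_except hn h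
  rw [← sum_seq_eq_card S a]
  exact ⟨three_mul_le_of_dominated_except (by omega) (outerSeq_period S a) (innerSeq_period S a)
    ha ha0, fun h4 => three_mul_le_of_dominated_except_of_mod_eq_four h4 (outerSeq_period S a)
    (innerSeq_period S a) ha ha0⟩

end Graph

/-! ### Dominating sets of small cardinality -/

section Constructions

variable {n : ℕ}

/-- The outer vertices with subscripts in `A` and the inner vertices with subscripts in `B`. -/
def columnSet (n : ℕ) (A B : Finset ℕ) : Finset (ZMod n ⊕ ZMod n) :=
  A.image (fun a : ℕ => Sum.inl (a : ZMod n)) ∪ B.image (fun b : ℕ => Sum.inr (b : ZMod n))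

theorem card_columnSet_le (A B : Finset ℕ) : (columnSet n A B).card ≤ A.card + B.card :=
  (Finset.card_union_le _ _).trans (add_le_add Finset.card_image_le Finset.card_image_le)

theorem inl_mem_columnSet {A B : Finset ℕ} {a : ℕ} (h : a ∈ A) :
    (Sum.inl (a : ZMod n) : ZMod n ⊕ ZMod n) ∈ columnSet n A B :=
  Finset.mem_union_left _ (Finset.mem_image_of_mem _ h)

theorem inr_mem_columnSet {A B : Finset ℕ} {a : ℕ} (h : a ∈ B) :
    (Sum.inr (a : ZMod n) : ZMod n ⊕ ZMod n) ∈ columnSet n A B :=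
  Finset.mem_union_right _ (Finset.mem_image_of_mem _ h)

theorem inl_mem_columnSet_iff {A B : Finset ℕ} {a : ℕ} (ha : a < n) (hA : ∀ b ∈ A, b < n) :
    (Sum.inl (a : ZMod n) : ZMod n ⊕ ZMod n) ∈ columnSet n A B ↔ a ∈ A := by
  refine ⟨fun h => ?_, inl_mem_columnSet⟩
  simp only [columnSet, Finset.mem_union, Finset.mem_image, Sum.inl.injEq, reduceCtorEq, and_false,
    exists_false, or_false] at h
  obtain ⟨b, hb, h⟩ := h
  rw [ZMod.natCast_eq_natCast_iff', Nat.mod_eq_of_lt ha, Nat.mod_eq_of_lt (hA b hb)] at h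
  rwa [← h]

theorem inr_mem_columnSet_iff {A B : Finset ℕ} {a : ℕ} (ha : a < n) (hB : ∀ b ∈ B, b < n) :
    (Sum.inr (a : ZMod n) : ZMod n ⊕ ZMod n) ∈ columnSet n A B ↔ a ∈ B := by
  refine ⟨fun h => ?_, inr_mem_columnSet⟩
  simp only [columnSet, Finset.mem_union, Finset.mem_image, Sum.inr.injEq, reduceCtorEq, and_false,
    exists_false, false_or] at h
  obtain ⟨b, hb, h⟩ := h
  rw [ZMod.natCast_eq_natCast_iff', Nat.mod_eq_of_lt ha, Nat.mod_eq_of_lt (hB b hb)] at h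
  rwa [← h]

theorem natCast_zmod_eq_of_add {a b c : ℕ} (h : a + c = b ∨ a + c = b + n) :
    (b : ZMod n) = a + c := by
  have : ((a + c : ℕ) : ZMod n) = b := by
    rcases h with h | h <;> simp [h]
  rw [← this]; push_cast; rfl

theorem isDominated_columnSet_inl (hn : 2 ≤ n) {A B : Finset ℕ} {a : ℕ}
    (h : a ∈ A ∨ a ∈ B ∨ ∃ b ∈ A, b + 1 = a ∨ b + 1 = a + n ∨ a + 1 = b ∨ a + 1 = b + n) :
    IsDominated (generalizedPetersen n 2) (columnSet n A B) (Sum.inl (a : ZMod n)) := by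
  rw [isDominated_inl_iff hn]
  rcases h with h | h | ⟨b, hb, h⟩
  · exact Or.inr (Or.inl (inl_mem_columnSet h))
  · exact Or.inr (Or.inr (Or.inr (inr_mem_columnSet h)))
  · have hb' := inl_mem_columnSet (n := n) (B := B) hb
    rcases or_assoc.2 h with h | h
    · rw [natCast_zmod_eq_of_add h]
      left; simpa using hb'
    · rw [natCast_zmod_eq_of_add h] at hb'
      right; right; left; simpa using hb'

theorem isDominated_columnSet_inr (hn : 3 ≤ n) {A B : Finset ℕ} {a : ℕ}
    (h : a ∈ A ∨ a ∈ B ∨ ∃ b ∈ B, b + 2 = a ∨ b + 2 = a + n ∨ a + 2 = b ∨ a + 2 = b + n) :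
    IsDominated (generalizedPetersen n 2) (columnSet n A B) (Sum.inr (a : ZMod n)) := by
  rw [isDominated_inr_iff hn]
  rcases h with h | h | ⟨b, hb, h⟩
  · exact Or.inr (Or.inr (Or.inr (inl_mem_columnSet h)))
  · exact Or.inr (Or.inl (inr_mem_columnSet h))
  · have hb' := inr_mem_columnSet (n := n) (A := A) hb
    rcases or_assoc.2 h with h | h
    · rw [natCast_zmod_eq_of_add h]
      left; simpa using hb'
    · rw [natCast_zmod_eq_of_add h] at hb'
      right; right; left; simpa using hb'

theorem card_filter_range_mod_five (m c : ℕ) (hc : c < 5) :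
    ((Finset.range m).filter (· % 5 = c)).card = (m + 4 - c) / 5 := by
  induction m with
  | zero => simp; omega
  | succ m ih =>
    rw [Finset.range_add_one, Finset.filter_insert]
    split_ifs with h
    · rw [Finset.card_insert_of_notMem (by simp), ih]; omega
    · rw [ih]; omega

/-- The pattern takes $u_0, v_1, u_2$ from each block of five columns. For $n \equiv 3$ the last
outer vertex $u_{n-1}$ is superfluous: $u_0$ dominates it and $v_1$ dominates $v_{n-1}$. -/
theorem exists_isDominatingSet_of_mod_five (hn : 3 ≤ n)
    (h5 : n % 5 = 0 ∨ n % 5 = 3 ∨ n % 5 = 4) :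
    ∃ D, IsDominatingSet (generalizedPetersen n 2) D ∧ D.card ≤ (3 * n + 4) / 5 := by
  let m := if n % 5 = 3 then n - 1 else n
  let A := (Finset.range m).filter (· % 5 = 0) ∪ (Finset.range m).filter (· % 5 = 2)
  let B := (Finset.range n).filter (· % 5 = 1)
  have hA : ∀ a, a ∈ A ↔ a < m ∧ (a % 5 = 0 ∨ a % 5 = 2) := fun a => by
    simp only [A, Finset.mem_union, Finset.mem_filter, Finset.mem_range]; tauto
  have hB : ∀ a, a ∈ B ↔ a < n ∧ a % 5 = 1 := fun a => by
    simp only [B, Finset.mem_filter, Finset.mem_range]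
  have hm : m = n - 1 ∧ n % 5 = 3 ∨ m = n ∧ n % 5 ≠ 3 := by
    by_cases h : n % 5 = 3 <;> simp [m, h]
  have : NeZero n := ⟨by omega⟩
  refine ⟨columnSet n A B, ?_, ?_⟩
  · rintro (i | i)
    · obtain ⟨a, ha, rfl⟩ : ∃ a < n, (a : ZMod n) = i := ⟨i.val, i.val_lt, by simp⟩
      refine isDominated_columnSet_inl (by omega) ?_
      simp only [hA, hB]
      by_cases h0 : a < m ∧ (a % 5 = 0 ∨ a % 5 = 2)
      · exact Or.inl h0
      · by_cases h1 : a % 5 = 1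
        · exact Or.inr (Or.inl ⟨ha, h1⟩)
        · right; right
          by_cases h3 : a % 5 = 3
          · exact ⟨a - 1, by omega, by omega⟩
          · by_cases h4 : a + 1 = n
            · exact ⟨0, by omega, by omega⟩
            · exact ⟨a + 1, by omega, by omega⟩
    · obtain ⟨a, ha, rfl⟩ : ∃ a < n, (a : ZMod n) = i := ⟨i.val, i.val_lt, by simp⟩
      refine isDominated_columnSet_inr hn ?_
      simp only [hA, hB]
      by_cases h0 : a < m ∧ (a % 5 = 0 ∨ a % 5 = 2)
      · exact Or.inl h0
      · by_cases h1 : a % 5 = 1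
        · exact Or.inr (Or.inl ⟨ha, h1⟩)
        · right; right
          by_cases h3 : a % 5 = 3
          · exact ⟨a - 2, by omega, by omega⟩
          · by_cases h4 : a + 1 = n
            · exact ⟨1, by omega, by omega⟩
            · exact ⟨a + 2, by omega, by omega⟩
  · refine (card_columnSet_le _ _).trans ?_
    have := Finset.card_union_le ((Finset.range m).filter (· % 5 = 0))
      ((Finset.range m).filter (· % 5 = 2))
    simp only [A, B]
    rw [card_filter_range_mod_five _ _ (by norm_num), card_filter_range_mod_five _ _ (by norm_num)]
      at this
    rw [card_filter_range_mod_five _ 1 (by norm_num)]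
    omega

/-- The pattern takes $u_0, v_2, v_3$ from each block. For $n \equiv 1$ the last outer vertex is
dropped, which leaves only $u_{n-2}$ undominated; for $n \equiv 2$ only $v_{n-1}$ is missed. -/
theorem exists_dominated_except_of_mod_five (hn : 3 ≤ n) (h5 : n % 5 = 1 ∨ n % 5 = 2) :
    ∃ (D : Finset (ZMod n ⊕ ZMod n)) (x : ZMod n ⊕ ZMod n), x ∉ D ∧
      (∀ v ≠ x, IsDominated (generalizedPetersen n 2) D v) ∧ 5 * D.card < 3 * n := by
  let m := if n % 5 = 1 then n - 1 else n
  let A := (Finset.range m).filter (· % 5 = 0)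
  let B := (Finset.range n).filter (· % 5 = 2) ∪ (Finset.range n).filter (· % 5 = 3)
  have hA : ∀ a, a ∈ A ↔ a < m ∧ a % 5 = 0 := fun a => by
    simp only [A, Finset.mem_filter, Finset.mem_range]
  have hB : ∀ a, a ∈ B ↔ a < n ∧ (a % 5 = 2 ∨ a % 5 = 3) := fun a => by
    simp only [B, Finset.mem_union, Finset.mem_filter, Finset.mem_range]; tauto
  have hm : m = n - 1 ∧ n % 5 = 1 ∨ m = n ∧ n % 5 = 2 := by
    rcases h5 with h | h <;> simp [m, h]
  have : NeZero n := ⟨by omega⟩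
  have hmn : m ≤ n := by omega
  have houter : ∀ a < n, (n % 5 = 1 → a ≠ n - 2) →
      IsDominated (generalizedPetersen n 2) (columnSet n A B) (Sum.inl (a : ZMod n)) := by
    intro a ha hx
    refine isDominated_columnSet_inl (by omega) ?_
    simp only [hA, hB]
    by_cases h0 : a < m ∧ a % 5 = 0
    · exact Or.inl h0
    · by_cases h1 : a % 5 = 2 ∨ a % 5 = 3
      · exact Or.inr (Or.inl ⟨ha, h1⟩)
      · right; right
        by_cases h3 : a + 1 = n
        · exact ⟨0, by omega, by omega⟩
        · by_cases h4 : a % 5 = 1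
          · exact ⟨a - 1, by omega, by omega⟩
          · exact ⟨a + 1, by omega, by omega⟩
  have hinner : ∀ a < n, (n % 5 = 2 → a ≠ n - 1) →
      IsDominated (generalizedPetersen n 2) (columnSet n A B) (Sum.inr (a : ZMod n)) := by
    intro a ha hx
    refine isDominated_columnSet_inr hn ?_
    simp only [hA, hB]
    by_cases h0 : a < m ∧ a % 5 = 0
    · exact Or.inl h0
    · by_cases h1 : a % 5 = 2 ∨ a % 5 = 3
      · exact Or.inr (Or.inl ⟨ha, h1⟩)
      · right; right
        by_cases h3 : a % 5 = 4 ∨ a + 1 = n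
        · exact ⟨a - 2, by omega, by omega⟩
        · exact ⟨a + 2, by omega, by omega⟩
  have hcard : 5 * (columnSet n A B).card < 3 * n := by
    have h1 := card_columnSet_le (n := n) A B
    have h2 := Finset.card_union_le ((Finset.range n).filter (· % 5 = 2))
      ((Finset.range n).filter (· % 5 = 3))
    simp only [A, B] at h1 ⊢
    rw [card_filter_range_mod_five _ _ (by norm_num)] at h1
    rw [card_filter_range_mod_five _ _ (by norm_num), card_filter_range_mod_five _ _ (by norm_num)]
      at h2
    omega
  rcases h5 with h5 | h5
  · refine ⟨_, Sum.inl ((n - 2 : ℕ) : ZMod n), ?_, ?_, hcard⟩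
    · rw [inl_mem_columnSet_iff (by omega) fun b hb => by rw [hA] at hb; omega, hA]
      omega
    · rintro (i | i) hi <;>
        obtain ⟨a, ha, rfl⟩ : ∃ a < n, (a : ZMod n) = i := ⟨i.val, i.val_lt, by simp⟩
      · exact houter a ha fun _ h => hi (by rw [h])
      · exact hinner a ha (by omega)
  · refine ⟨_, Sum.inr ((n - 1 : ℕ) : ZMod n), ?_, ?_, hcard⟩
    · rw [inr_mem_columnSet_iff (by omega) fun b hb => by rw [hB] at hb; omega, hB]
      omega
    · rintro (i | i) hi <;>
        obtain ⟨a, ha, rfl⟩ : ∃ a < n, (a : ZMod n) = i := ⟨i.val, i.val_lt, by simp⟩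
      · exact houter a ha (by omega)
      · exact hinner a ha fun _ h => hi (by rw [h])

end Constructions

/-! ### Domination numbers under removal of vertices and edges -/

section Domination

variable {V W : Type*}

theorem dominationNumber_le {G : SimpleGraph V} {S : Finset V} (h : IsDominatingSet G S) :
    dominationNumber G ≤ S.card :=
  Nat.sInf_le ⟨S, h, rfl⟩

theorem le_dominationNumber [Finite V] {G : SimpleGraph V} {k : ℕ}
    (h : ∀ S, IsDominatingSet G S → k ≤ S.card) : k ≤ dominationNumber G := by
  have := Fintype.ofFinite V
  refine le_csInf ⟨_, Finset.univ, fun v => Or.inl (Finset.mem_univ v), rfl⟩ ?_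
  rintro _ ⟨S, hS, rfl⟩
  exact h S hS

theorem dominationNumber_removeVertices_le {G : SimpleGraph V} {X S : Finset V}
    (hX : Disjoint S X) (h : ∀ v ∉ X, IsDominated G S v) :
    dominationNumber (removeVertices G X) ≤ S.card := by
  classical
  have hS : ∀ v ∈ S, v ∉ X := fun v hv => Finset.disjoint_left.1 hX hv
  refine (dominationNumber_le (S := S.subtype (· ∈ {v | v ∉ X})) ?_).trans
    ((Finset.card_subtype _ _).trans_le (Finset.card_filter_le _ _))
  rintro ⟨v, hv⟩
  rcases h v hv with h | ⟨w, hw, h⟩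
  · exact Or.inl (Finset.mem_subtype.2 h)
  · exact Or.inr ⟨⟨w, hS w hw⟩, Finset.mem_subtype.2 hw, h⟩

theorem le_dominationNumber_removeVertices [Finite V] {G : SimpleGraph V} {X : Finset V} {k : ℕ}
    (h : ∀ S, (∀ v ∉ X, IsDominated G S v) → k ≤ S.card) :
    k ≤ dominationNumber (removeVertices G X) := by
  refine le_dominationNumber fun S hS => ?_
  rw [← Finset.card_map (Function.Embedding.subtype _)]
  refine h _ fun v hv => ?_
  rcases hS ⟨v, hv⟩ with h | ⟨w, hw, h⟩
  · exact Or.inl (Finset.mem_map_of_mem (Function.Embedding.subtype _) h)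
  · exact Or.inr ⟨_, Finset.mem_map_of_mem (Function.Embedding.subtype _) hw, h⟩

theorem dominationNumber_removeVertices_empty [Finite V] (G : SimpleGraph V) :
    dominationNumber (removeVertices G ∅) = dominationNumber G :=
  le_antisymm
    (le_dominationNumber fun _ hS =>
      dominationNumber_removeVertices_le (Finset.disjoint_empty_right _) fun v _ => hS v)
    (le_dominationNumber_removeVertices fun _ hS =>
      dominationNumber_le fun v => hS v (Finset.notMem_empty v))

theorem dominationNumber_pos [Finite V] [Nonempty V] (G : SimpleGraph V) :
    0 < dominationNumber G := by
  refine le_dominationNumber fun S hS => Finset.card_pos.2 ?_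
  rcases hS (Classical.arbitrary V) with h | ⟨w, hw, -⟩
  exacts [⟨_, h⟩, ⟨w, hw⟩]

theorem le_alterationDominationNumber [Finite V] [Nonempty V] {G : SimpleGraph V} {k : ℕ}
    (h : ∀ X, dominationNumber (removeVertices G X) ≠ dominationNumber G → k ≤ X.card) :
    k ≤ alterationDominationNumber G := by
  have := Fintype.ofFinite V
  -- Nonemptiness matters here: the infimum of the empty set would be 0.
  refine le_csInf ⟨_, Finset.univ, ?_, rfl⟩ ?_
  · have : dominationNumber (removeVertices G Finset.univ) ≤ 0 :=
      dominationNumber_removeVertices_le (S := ∅) (Finset.disjoint_empty_left _) (by simp)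
    have := dominationNumber_pos G
    omega
  · rintro _ ⟨X, hX, rfl⟩
    exact h X hX

/-- Losing `ab` hurts only an end outside `D` whose sole dominator is the other end. -/
theorem isDominatingSet_deleteEdges_of_harmless {G : SimpleGraph V} {D : Finset V} {a b : V}
    (hD : IsDominatingSet G D)
    (ha : b ∈ D → a ∈ D ∨ ∃ c ∈ D, c ≠ b ∧ G.Adj c a)
    (hb : a ∈ D → b ∈ D ∨ ∃ c ∈ D, c ≠ a ∧ G.Adj c b) :
    IsDominatingSet (G.deleteEdges {s(a, b)}) D := by
  intro v
  rcases hD v with h | ⟨w, hw, h⟩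
  · exact Or.inl h
  by_cases he : s(w, v) = s(a, b)
  · rcases Sym2.eq_iff.1 he with ⟨rfl, rfl⟩ | ⟨rfl, rfl⟩
    · rcases hb hw with h | ⟨c, hc, hcw, h⟩
      · exact Or.inl h
      · refine Or.inr ⟨c, hc, ?_⟩
        simp [SimpleGraph.deleteEdges_adj, h, hcw, h.ne]
    · rcases ha hw with h | ⟨c, hc, hcw, h⟩
      · exact Or.inl h
      · refine Or.inr ⟨c, hc, ?_⟩
        simp [SimpleGraph.deleteEdges_adj, h, hcw, h.ne]
  · exact Or.inr ⟨w, hw, by simpa [SimpleGraph.deleteEdges_adj, h] using he⟩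

theorem IsDominatingSet.map_iso {G : SimpleGraph V} {H : SimpleGraph W} {D : Finset V}
    (hD : IsDominatingSet G D) (φ : G ≃g H) :
    IsDominatingSet H (D.map φ.toEquiv.toEmbedding) := by
  intro v
  obtain ⟨v, rfl⟩ := φ.surjective v
  rcases hD v with h | ⟨w, hw, h⟩
  · exact Or.inl (Finset.mem_map_of_mem _ h)
  · exact Or.inr ⟨_, Finset.mem_map_of_mem _ hw, φ.map_adj_iff.2 h⟩

theorem IsDominatingSet.map_deleteEdges {G : SimpleGraph V} {D : Finset V} {a b : V}
    (hD : IsDominatingSet (G.deleteEdges {s(a, b)}) D) (φ : G ≃g G) :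
    IsDominatingSet (G.deleteEdges {s(φ a, φ b)}) (D.map φ.toEquiv.toEmbedding) := by
  intro v
  obtain ⟨v, rfl⟩ := φ.surjective v
  rcases hD v with h | ⟨w, hw, h⟩
  · exact Or.inl (Finset.mem_map_of_mem _ h)
  · refine Or.inr ⟨_, Finset.mem_map_of_mem _ hw, ?_⟩
    simp only [SimpleGraph.deleteEdges_adj, Set.mem_singleton_iff, Sym2.eq_iff] at h ⊢
    refine ⟨φ.map_adj_iff.2 h.1, fun h' => h.2 ?_⟩
    simpa using h'

end Domination

/-! ### Rotations of $P(n,2)$ and deletion of a single edge -/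

section Petersen

variable {n : ℕ}

/-- Rotation of `P(n,k)` by `t` columns. -/
def columnRotation (n k : ℕ) (t : ZMod n) : generalizedPetersen n k ≃g generalizedPetersen n k where
  toEquiv := Equiv.sumCongr (Equiv.addRight t) (Equiv.addRight t)
  map_rel_iff' := by
    have h : ∀ x y c : ZMod n, y + t = x + t + c ↔ y = x + c := fun x y c => by
      rw [add_right_comm, add_left_inj]
    rintro (a | a) (b | b) <;>
      simp [generalizedPetersen_adj_inl_inl, generalizedPetersen_adj_inr_inr,
        generalizedPetersen_adj_inl_inr, generalizedPetersen_adj_inr_inl, h]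

@[simp] theorem columnRotation_inl (k : ℕ) (t i : ZMod n) :
    columnRotation n k t (Sum.inl i) = Sum.inl (i + t) := rfl

@[simp] theorem columnRotation_inr (k : ℕ) (t i : ZMod n) :
    columnRotation n k t (Sum.inr i) = Sum.inr (i + t) := rfl

theorem exists_inl_notMem [NeZero n] {D : Finset (ZMod n ⊕ ZMod n)} (h : D.card < n) :
    ∃ i, Sum.inl i ∉ D := by
  by_contra! hD
  have := Finset.card_le_card_of_injOn (s := Finset.univ) (t := D)
    (fun i : ZMod n => (Sum.inl i : ZMod n ⊕ ZMod n)) (fun i _ => hD i) fun i _ j _ h => by simpa using h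
  rw [Finset.card_univ, ZMod.card] at this
  omega

theorem exists_inr_notMem [NeZero n] {D : Finset (ZMod n ⊕ ZMod n)} (h : D.card < n) :
    ∃ i, Sum.inr i ∉ D := by
  by_contra! hD
  have := Finset.card_le_card_of_injOn (s := Finset.univ) (t := D)
    (fun i : ZMod n => (Sum.inr i : ZMod n ⊕ ZMod n)) (fun i _ => hD i) fun i _ j _ h => by simpa using h
  rw [Finset.card_univ, ZMod.card] at this
  omega

/-- Otherwise `D` meets every column and has at least `n` elements. -/
theorem exists_spoke_not_mixed [NeZero n] {D : Finset (ZMod n ⊕ ZMod n)} (h : D.card < n) :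
    ∃ i, Sum.inl i ∈ D ↔ Sum.inr i ∈ D := by
  by_contra! hD
  have key : ∀ i, ∃ x ∈ D, x.elim id id = i := fun i => by
    by_cases hi : Sum.inl i ∈ D
    · exact ⟨_, hi, rfl⟩
    · exact ⟨Sum.inr i, by have := hD i; tauto, rfl⟩
  have := Finset.card_le_card (s := Finset.univ) (t := D.image fun x => x.elim id id)
    fun i _ => Finset.mem_image.2 (key i)
  have h2 := this.trans Finset.card_image_le
  rw [Finset.card_univ, ZMod.card] at h2
  omega

/-- A set of fewer than `n` vertices misses some outer and some inner vertex, and rotations act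
transitively on each kind. -/
theorem exists_isDominatingSet_avoiding [NeZero n] {k : ℕ} {D : Finset (ZMod n ⊕ ZMod n)}
    (hD : IsDominatingSet (generalizedPetersen n k) D) (h : D.card < n) (x : ZMod n ⊕ ZMod n) :
    ∃ D', IsDominatingSet (generalizedPetersen n k) D' ∧ x ∉ D' ∧ D'.card = D.card := by
  have key : ∀ y ∉ D, ∀ t, columnRotation n k t y = x →
      ∃ D', IsDominatingSet (generalizedPetersen n k) D' ∧ x ∉ D' ∧ D'.card = D.card := by
    rintro y hy t rfl
    refine ⟨_, hD.map_iso (columnRotation n k t), ?_, Finset.card_map _⟩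
    exact fun hmem => hy ((Finset.mem_map' (columnRotation n k t).toEquiv.toEmbedding).1 hmem)
  obtain i | i := x
  · obtain ⟨j, hj⟩ := exists_inl_notMem h
    exact key _ hj (i - j) (by simp)
  · obtain ⟨j, hj⟩ := exists_inr_notMem h
    exact key _ hj (i - j) (by simp)

/-- An edge with both ends or no end in `D` is harmless. If there is none, membership alternates
along the outer cycle, and a vertex outside `D` has a second outer neighbour in `D`. -/
theorem exists_isDominatingSet_deleteEdges_outer (hn : 3 ≤ n) {D : Finset (ZMod n ⊕ ZMod n)}
    (hD : IsDominatingSet (generalizedPetersen n 2) D) :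
    ∃ i : ZMod n, IsDominatingSet
      ((generalizedPetersen n 2).deleteEdges {s(Sum.inl i, Sum.inl (i + 1))}) D := by
  have : Fact (1 < n) := ⟨by omega⟩
  have h2 := two_ne_zero_zmod hn
  by_cases h : ∃ i : ZMod n, Sum.inl i ∈ D ↔ Sum.inl (i + 1) ∈ D
  · obtain ⟨i, hi⟩ := h
    exact ⟨i, isDominatingSet_deleteEdges_of_harmless hD (fun h => Or.inl (hi.2 h))
      fun h => Or.inl (hi.1 h)⟩
  · push Not at h
    obtain ⟨i, hi, hi'⟩ : ∃ i : ZMod n, Sum.inl i ∈ D ∧ Sum.inl (i + 1) ∉ D := by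
      rcases h 0 with h0 | h0
      · exact ⟨_, h0⟩
      · refine ⟨0 + 1, h0.2, ?_⟩
        rcases h (0 + 1) with h1 | h1
        exacts [h1.2, absurd h0.2 h1.1]
    refine ⟨i, isDominatingSet_deleteEdges_of_harmless hD (fun h => absurd h hi') fun _ =>
      Or.inr ⟨Sum.inl (i + 1 + 1), ?_, ?_, ?_⟩⟩
    · rcases h (i + 1) with h1 | h1
      exacts [absurd h1.1 hi', h1.2]
    · rw [add_assoc, one_add_one_eq_two]
      simpa using h2
    · simp [generalizedPetersen_adj_inl_inl]

/-- The alternation argument needs $v_{i+4} \ne v_i$, which for $n \ge 3$ fails only at $n = 4$;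
that case gets an explicit set. -/
theorem exists_isDominatingSet_deleteEdges_inner (hn : 3 ≤ n) (hn4 : n ≠ 4)
    {D : Finset (ZMod n ⊕ ZMod n)} (hD : IsDominatingSet (generalizedPetersen n 2) D) :
    ∃ i : ZMod n, IsDominatingSet
      ((generalizedPetersen n 2).deleteEdges {s(Sum.inr i, Sum.inr (i + 2))}) D := by
  have h2 := two_ne_zero_zmod hn
  have h4 : (2 + 2 : ZMod n) ≠ 0 := by
    intro h
    have hd := (ZMod.natCast_eq_zero_iff 4 n).1 (by push_cast; rw [← h]; norm_num)
    have := Nat.le_of_dvd (by norm_num) hd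
    interval_cases n <;> omega
  by_cases h : ∃ i : ZMod n, Sum.inr i ∈ D ↔ Sum.inr (i + 2) ∈ D
  · obtain ⟨i, hi⟩ := h
    exact ⟨i, isDominatingSet_deleteEdges_of_harmless hD (fun h => Or.inl (hi.2 h))
      fun h => Or.inl (hi.1 h)⟩
  · push Not at h
    obtain ⟨i, hi, hi'⟩ : ∃ i : ZMod n, Sum.inr i ∈ D ∧ Sum.inr (i + 2) ∉ D := by
      rcases h 0 with h0 | h0
      · exact ⟨_, h0⟩
      · refine ⟨0 + 2, h0.2, ?_⟩
        rcases h (0 + 2) with h1 | h1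
        exacts [h1.2, absurd h0.2 h1.1]
    refine ⟨i, isDominatingSet_deleteEdges_of_harmless hD (fun h => absurd h hi') fun _ =>
      Or.inr ⟨Sum.inr (i + 2 + 2), ?_, ?_, ?_⟩⟩
    · rcases h (i + 2) with h1 | h1
      exacts [absurd h1.1 hi', h1.2]
    · rw [add_assoc]
      simpa using h4
    · simp [generalizedPetersen_adj_inr_inr, h2]

theorem exists_isDominatingSet_deleteEdges_spoke [NeZero n] {k : ℕ}
    {D : Finset (ZMod n ⊕ ZMod n)} (hD : IsDominatingSet (generalizedPetersen n k) D)
    (h : D.card < n) :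
    ∃ i : ZMod n, IsDominatingSet
      ((generalizedPetersen n k).deleteEdges {s(Sum.inl i, Sum.inr i)}) D := by
  obtain ⟨i, hi⟩ := exists_spoke_not_mixed h
  exact ⟨i, isDominatingSet_deleteEdges_of_harmless hD (fun h => Or.inl (hi.2 h))
    fun h => Or.inl (hi.1 h)⟩

theorem exists_isDominatingSet_deleteEdges_inner_four :
    ∃ (D : Finset (ZMod 4 ⊕ ZMod 4)) (i : ZMod 4), D.card = 3 ∧ IsDominatingSet
      ((generalizedPetersen 4 2).deleteEdges {s(Sum.inr i, Sum.inr (i + 2))}) D := by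
  refine ⟨{Sum.inl 0, Sum.inr 2, Sum.inr 1}, 0, by decide,
    isDominatingSet_deleteEdges_of_harmless ?_ (fun _ => ?_) ?_⟩
  · rintro (i | i)
    · refine (isDominated_inl_iff (by norm_num)).2 ?_
      revert i; decide
    · refine (isDominated_inr_iff (by norm_num)).2 ?_
      revert i; decide
  · exact Or.inr ⟨Sum.inl 0, by decide, by decide, by simp [generalizedPetersen_adj_inl_inr]⟩
  · exact fun h => absurd h (by decide)

/-- If `n` is `0`, `3` or `4` modulo 5, every edge of `P(n,2)` is avoidable: some dominating set of
minimum size still dominates after its deletion. -/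
theorem exists_isDominatingSet_deleteEdges (hn : 3 ≤ n)
    (h5 : n % 5 = 0 ∨ n % 5 = 3 ∨ n % 5 = 4) {x y : ZMod n ⊕ ZMod n}
    (hxy : (generalizedPetersen n 2).Adj x y) :
    ∃ D, IsDominatingSet ((generalizedPetersen n 2).deleteEdges {s(x, y)}) D ∧
      D.card ≤ (3 * n + 4) / 5 := by
  have : NeZero n := ⟨by omega⟩
  obtain ⟨D, hD, hcard⟩ := exists_isDominatingSet_of_mod_five hn h5
  have hlt : D.card < n := by omega
  -- Rotations are transitive on outer edges, inner edges and spokes, so one harmless edge of each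
  -- kind suffices.
  have rotated : ∀ {D x y x' y'}, IsDominatingSet ((generalizedPetersen n 2).deleteEdges
      {s(x, y)}) D → D.card ≤ (3 * n + 4) / 5 → ∀ t, columnRotation n 2 t x = x' →
      columnRotation n 2 t y = y' → ∃ D, IsDominatingSet ((generalizedPetersen n 2).deleteEdges
      {s(x', y')}) D ∧ D.card ≤ (3 * n + 4) / 5 := by
    rintro D x y _ _ h hD t rfl rfl
    exact ⟨_, h.map_deleteEdges _, (Finset.card_map _).trans_le hD⟩
  have outer : ∀ i : ZMod n, ∃ D, IsDominatingSet ((generalizedPetersen n 2).deleteEdges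
      {s(Sum.inl i, Sum.inl (i + 1))}) D ∧ D.card ≤ (3 * n + 4) / 5 := by
    intro i
    obtain ⟨j, hj⟩ := exists_isDominatingSet_deleteEdges_outer hn hD
    exact rotated hj hcard (i - j) (by simp) (by simp [add_right_comm])
  have inner : ∀ i : ZMod n, ∃ D, IsDominatingSet ((generalizedPetersen n 2).deleteEdges
      {s(Sum.inr i, Sum.inr (i + 2))}) D ∧ D.card ≤ (3 * n + 4) / 5 := by
    intro i
    obtain ⟨D, j, hcard, hj⟩ : ∃ (D : _) (j : ZMod n), D.card ≤ (3 * n + 4) / 5 ∧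
        IsDominatingSet ((generalizedPetersen n 2).deleteEdges
          {s(Sum.inr j, Sum.inr (j + 2))}) D := by
      by_cases hn4 : n = 4
      · subst hn4
        obtain ⟨D, j, h, hj⟩ := exists_isDominatingSet_deleteEdges_inner_four
        exact ⟨D, j, by omega, hj⟩
      · obtain ⟨j, hj⟩ := exists_isDominatingSet_deleteEdges_inner hn hn4 hD
        exact ⟨D, j, hcard, hj⟩
    exact rotated hj hcard (i - j) (by simp) (by simp [add_right_comm])
  have spoke : ∀ i : ZMod n, ∃ D, IsDominatingSet ((generalizedPetersen n 2).deleteEdges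
      {s(Sum.inl i, Sum.inr i)}) D ∧ D.card ≤ (3 * n + 4) / 5 := by
    intro i
    obtain ⟨j, hj⟩ := exists_isDominatingSet_deleteEdges_spoke hD hlt
    exact rotated hj hcard (i - j) (by simp) (by simp)
  obtain i | i := x <;> obtain j | j := y
  · rw [generalizedPetersen_adj_inl_inl] at hxy
    obtain ⟨-, rfl | rfl⟩ := hxy
    exacts [outer i, Sym2.eq_swap (a := Sum.inl j) ▸ outer j]
  · rw [generalizedPetersen_adj_inl_inr] at hxy
    exact hxy ▸ spoke i
  · rw [generalizedPetersen_adj_inr_inl] at hxy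
    exact hxy ▸ Sym2.eq_swap (a := Sum.inl i) ▸ spoke i
  · rw [generalizedPetersen_adj_inr_inr] at hxy
    obtain ⟨-, rfl | rfl⟩ := hxy
    exacts [inner i, Sym2.eq_swap (a := Sum.inr j) ▸ inner j]

/-! ### Exact domination number and the two invariants -/

/-- For $n \equiv 0, 3$ one has $3n \equiv 0, 4 \pmod 5$, and lowering $3n$ by 3 does not change the
rounded-up quotient. For $n \equiv 4$ one has $3n \equiv 2$, which tolerates a loss of 1 but not of
2. -/
theorem le_card_of_dominated_except (hn : 3 ≤ n) (h5 : n % 5 = 0 ∨ n % 5 = 3 ∨ n % 5 = 4)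
    {S : Finset (ZMod n ⊕ ZMod n)} {x : ZMod n ⊕ ZMod n}
    (h : ∀ v ≠ x, IsDominated (generalizedPetersen n 2) S v) : (3 * n + 4) / 5 ≤ S.card := by
  have := three_mul_le_card_of_dominated_except hn h
  omega

theorem dominationNumber_eq_of_mod_five (hn : 3 ≤ n) (h5 : n % 5 = 0 ∨ n % 5 = 3 ∨ n % 5 = 4) :
    dominationNumber (generalizedPetersen n 2) = (3 * n + 4) / 5 := by
  have : NeZero n := ⟨by omega⟩
  obtain ⟨D, hD, hcard⟩ := exists_isDominatingSet_of_mod_five hn h5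
  refine le_antisymm ((dominationNumber_le hD).trans hcard) (le_dominationNumber fun S hS => ?_)
  exact le_card_of_dominated_except hn h5 (x := Sum.inl 0) fun v _ => hS v

theorem dominationNumber_removeVertices_singleton_eq (hn : 3 ≤ n)
    (h5 : n % 5 = 0 ∨ n % 5 = 3 ∨ n % 5 = 4) (x : ZMod n ⊕ ZMod n) :
    dominationNumber (removeVertices (generalizedPetersen n 2) {x}) =
      dominationNumber (generalizedPetersen n 2) := by
  have : NeZero n := ⟨by omega⟩
  rw [dominationNumber_eq_of_mod_five hn h5]
  obtain ⟨D, hD, hcard⟩ := exists_isDominatingSet_of_mod_five hn h5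
  obtain ⟨D', hD', hx, hcard'⟩ := exists_isDominatingSet_avoiding hD (by omega) x
  refine le_antisymm ((dominationNumber_removeVertices_le
    (Finset.disjoint_singleton_right.2 hx) fun v _ => hD' v).trans (hcard'.trans_le hcard)) ?_
  exact le_dominationNumber_removeVertices fun S hS =>
    le_card_of_dominated_except hn h5 fun v hv => hS v (by simpa using hv)

theorem one_le_alterationDominationNumber (hn : 3 ≤ n) :
    1 ≤ alterationDominationNumber (generalizedPetersen n 2) := by
  have : NeZero n := ⟨by omega⟩
  refine le_alterationDominationNumber fun X hX => Nat.one_le_iff_ne_zero.2 fun h => hX ?_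
  rw [Finset.card_eq_zero.1 h, dominationNumber_removeVertices_empty]

theorem alterationDominationNumber_le_one (hn : 3 ≤ n) (h5 : n % 5 = 1 ∨ n % 5 = 2) :
    alterationDominationNumber (generalizedPetersen n 2) ≤ 1 := by
  have : NeZero n := ⟨by omega⟩
  obtain ⟨D, x, hx, hD, hcard⟩ := exists_dominated_except_of_mod_five hn h5
  refine Nat.sInf_le ⟨{x}, ne_of_lt ?_, Finset.card_singleton x⟩
  have h1 : dominationNumber (removeVertices (generalizedPetersen n 2) {x}) ≤ D.card :=
    dominationNumber_removeVertices_le (Finset.disjoint_singleton_right.2 hx)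
      fun v hv => hD v (by simpa using hv)
  have h2 : D.card + 1 ≤ dominationNumber (generalizedPetersen n 2) :=
    le_dominationNumber fun S hS => by
      have := three_mul_le_card_of_isDominatingSet hn hS
      omega
  omega

theorem two_le_alterationDominationNumber (hn : 3 ≤ n)
    (h5 : n % 5 = 0 ∨ n % 5 = 3 ∨ n % 5 = 4) :
    2 ≤ alterationDominationNumber (generalizedPetersen n 2) := by
  have : NeZero n := ⟨by omega⟩
  refine le_alterationDominationNumber fun X hX => ?_
  by_contra! hlt
  rcases Nat.le_one_iff_eq_zero_or_eq_one.1 (Nat.lt_succ_iff.1 hlt) with h | h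
  · rw [Finset.card_eq_zero.1 h, dominationNumber_removeVertices_empty] at hX
    exact hX rfl
  · obtain ⟨x, rfl⟩ := Finset.card_eq_one.1 h
    exact hX (dominationNumber_removeVertices_singleton_eq hn h5 x)

/-- Isolating the outer vertex `u_0` increases the domination number. -/
theorem exists_edges_dominationNumber_lt (hn : 3 ≤ n) (h5 : n % 5 = 0 ∨ n % 5 = 3 ∨ n % 5 = 4) :
    ∃ F : Finset (Sym2 (ZMod n ⊕ ZMod n)),
      (F : Set (Sym2 (ZMod n ⊕ ZMod n))) ⊆ (generalizedPetersen n 2).edgeSet ∧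
      dominationNumber (generalizedPetersen n 2) < dominationNumber
        ((generalizedPetersen n 2).deleteEdges (F : Set (Sym2 (ZMod n ⊕ ZMod n)))) ∧
      F.card ≤ 3 := by
  have : NeZero n := ⟨by omega⟩
  have : Fact (1 < n) := ⟨by omega⟩
  let G := generalizedPetersen n 2
  let x : ZMod n ⊕ ZMod n := Sum.inl 0
  let F : Finset (Sym2 (ZMod n ⊕ ZMod n)) :=
    {s(x, Sum.inl 1), s(x, Sum.inl (-1)), s(x, Sum.inr 0)}
  have hF : ∀ w, G.Adj w x → s(w, x) ∈ F := by
    rintro (w | w) h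
    · obtain ⟨-, h | h⟩ := generalizedPetersen_adj_inl_inl.1 h
      · obtain rfl : w = -1 := by linear_combination -h
        simp [F, Sym2.eq_swap]
      · obtain rfl : w = 1 := by simpa using h
        simp [F, Sym2.eq_swap]
    · obtain rfl := generalizedPetersen_adj_inr_inl.1 h
      simp [F, Sym2.eq_swap]
  have hFsub : (F : Set (Sym2 (ZMod n ⊕ ZMod n))) ⊆ G.edgeSet := by
    intro e he
    simp only [F, Finset.coe_insert, Finset.coe_singleton, Set.mem_insert_iff,
      Set.mem_singleton_iff] at he
    rcases he with rfl | rfl | rfl <;>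
      simp [G, x, generalizedPetersen_adj_inl_inl, generalizedPetersen_adj_inl_inr]
  refine ⟨F, hFsub, ?_, Finset.card_le_three⟩
  rw [dominationNumber_eq_of_mod_five hn h5]
  refine Nat.lt_of_succ_le (le_dominationNumber fun S hS => ?_)
  have hx : x ∈ S := by
    rcases hS x with h | ⟨w, -, h⟩
    · exact h
    · rw [SimpleGraph.deleteEdges_adj] at h
      exact absurd (hF w h.1) h.2
  rw [← Finset.card_erase_add_one hx]
  -- The isolated vertex `x` dominates nothing but itself, so erasing it leaves every other vertex
  -- dominated.
  refine Nat.succ_le_succ (le_card_of_dominated_except hn h5 (x := x) fun v hv => ?_)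
  rcases hS v with h | ⟨w, hw, h⟩
  · exact Or.inl (Finset.mem_erase.2 ⟨hv, h⟩)
  · rw [SimpleGraph.deleteEdges_adj] at h
    refine Or.inr ⟨w, Finset.mem_erase.2 ⟨?_, hw⟩, h.1⟩
    rintro rfl
    exact h.2 (Sym2.eq_swap ▸ hF v h.1.symm)

theorem bondageNumber_le_three (hn : 3 ≤ n) (h5 : n % 5 = 0 ∨ n % 5 = 3 ∨ n % 5 = 4) :
    bondageNumber (generalizedPetersen n 2) ≤ 3 := by
  obtain ⟨F, hF, hlt, hcard⟩ := exists_edges_dominationNumber_lt hn h5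
  refine le_trans (Nat.sInf_le ?_) hcard
  exact ⟨F, hF, hlt, rfl⟩

theorem two_le_bondageNumber (hn : 3 ≤ n) (h5 : n % 5 = 0 ∨ n % 5 = 3 ∨ n % 5 = 4) :
    2 ≤ bondageNumber (generalizedPetersen n 2) := by
  obtain ⟨F, hF, hlt, -⟩ := exists_edges_dominationNumber_lt hn h5
  refine le_csInf ⟨F.card, F, hF, hlt, rfl⟩ ?_
  rintro _ ⟨F, hF, hlt, rfl⟩
  by_contra! hcard
  rcases Nat.le_one_iff_eq_zero_or_eq_one.1 (Nat.lt_succ_iff.1 hcard) with h | h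
  · simp [Finset.card_eq_zero.1 h] at hlt
  · obtain ⟨e, rfl⟩ := Finset.card_eq_one.1 h
    induction e with | _ x y
    rw [Finset.coe_singleton] at hF hlt
    obtain ⟨D, hD, hD'⟩ :=
      exists_isDominatingSet_deleteEdges hn h5 ((SimpleGraph.mem_edgeSet _).1 (hF rfl))
    have := dominationNumber_le hD
    rw [dominationNumber_eq_of_mod_five hn h5] at hlt
    omega

end Petersen

theorem mainTheorem2 (n : ℕ) (hn : 3 ≤ n) :
    ((n % 5 = 1 ∨ n % 5 = 2) →
      alterationDominationNumber (generalizedPetersen n 2) = 1) ∧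
    (¬ (n % 5 = 1 ∨ n % 5 = 2) →
      2 ≤ alterationDominationNumber (generalizedPetersen n 2)) ∧
    ((n % 5 = 0 ∨ n % 5 = 3 ∨ n % 5 = 4) →
      2 ≤ bondageNumber (generalizedPetersen n 2) ∧
      bondageNumber (generalizedPetersen n 2) ≤ 3) :=
  ⟨fun h => le_antisymm (alterationDominationNumber_le_one hn h)
      (one_le_alterationDominationNumber hn),
    fun h => two_le_alterationDominationNumber hn (by omega),
    fun h => ⟨two_le_bondageNumber hn h, bondageNumber_le_three hn h⟩⟩
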